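/- For $g\ge 1$ let $$\pi=\pi_1(\Sigma_g)=\langle x_1,\dots,x_{2g}\mid [x_1,x_2][x_3,x_4]\cdots[x_{2g-1},x_{2g}]=1\rangle,\qquad [x,y]=x^{-1}y^{-1}xy,$$ be the fundamental group of the closed oriented surface of genus $g$. Identify $\pi/[\pi,\pi]$ with $\mathbb{Z}^{2g}$ by sending the class of $x_i$ to the standard basis vector $e_i$, and regard $[\pi,\pi]^{\mathrm{ab}}$ as a $\mathbb{Z}[\mathbb{Z}^{2g}]$-module via the action of $\pi/[\pi,\pi]$ induced by the conjugation action of $\pi$ on $[\pi,\pi]$. Let $\omega=e_1\wedge e_2+e_3\wedge e_4+\cdots+e_{2g-1}\wedge e_{2g}\in\wedge^2\mathbb{Z}^{2g}$. Then for all $g\ge 1$ the subgroup $\mathbb{Z}\omega\subset\wedge^2\mathbb{Z}^{2g}$ is infinite cyclic, and for all $k\ge 0$ there is an isomorphism of abelian groups $$H_k\bigl(\mathbb{Z}^{2g};[\pi,\pi]^{\mathrm{ab}}\bigr)\cong\begin{cases}(\wedge^2\mathbb{Z}^{2g})/\mathbb{Z}\omega & \text{if } k=0,\\ \wedge^{k+2}\mathbb{Z}^{2g}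 & \text{if } k\ge 1.\end{cases}$$ In particular, $[\pi,\pi]^{\mathrm{ab}}$ is not a free $\mathbb{Z}[\mathbb{Z}^{2g}]$-module for $g\ge 2$. -/

import Mathlib

noncomputable section

namespace SurfaceCommutator

/-! ### The abelianization of the commutator subgroup as a module over the abelianization -/

section General

variable (G : Type) [Group G]

/-- The conjugation action of `G` on `[G, G]^ab` (written additively): `w` sends the class of
`c` to the class of `w * c * w⁻¹`. -/
def conjRep : Representation ℤ G (Additive (Abelianization (commutator G))) where
  toFun w := (MonoidHom.toAdditive
    (Abelianization.map (MulAut.conjNormal (H := commutator G) w).toMonoidHom)).toIntLinearMap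
  map_one' := by
    ext a
    induction a using Additive.rec with | _ a =>
    induction a using QuotientGroup.induction_on with | _ c =>
    change Additive.ofMul (Abelianization.of (MulAut.conjNormal (1 : G) c)) = _
    rw [map_one]
    rfl
  map_mul' w w' := by
    ext a
    induction a using Additive.rec with | _ a =>
    induction a using QuotientGroup.induction_on with | _ c =>
    change Additive.ofMul (Abelianization.of (MulAut.conjNormal (w * w') c)) = _
    rw [map_mul]
    rfl

theorem conjRep_apply (w : G) (c : commutator G) :
    conjRep G w (Additive.ofMul (Abelianization.of c)) =
      Additive.ofMul (Abelianization.of (MulAut.conjNormal w c)) := rfl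

/-- Elements of `[G, G]` act trivially on `[G, G]^ab`. -/
theorem commutator_le_ker_conjRep : commutator G ≤ (conjRep G).ker := by
  intro w hw
  rw [MonoidHom.mem_ker]
  ext a
  induction a using Additive.rec with | _ a =>
  induction a using QuotientGroup.induction_on with | _ c =>
  change conjRep G w (Additive.ofMul (Abelianization.of c)) =
    Additive.ofMul (Abelianization.of c)
  rw [conjRep_apply]
  have h : MulAut.conjNormal w c = (⟨w, hw⟩ : commutator G) * c * (⟨w, hw⟩ : commutator G)⁻¹ := by
    ext
    simp
  congr 1
  rw [h, map_mul, map_mul, map_inv, mul_comm (Abelianization.of _) (Abelianization.of c),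
    mul_inv_cancel_right]

/-- The representation of `G^ab = G / [G, G]` on `[G, G]^ab` induced by conjugation. -/
def conjRepAb : Representation ℤ (Abelianization G) (Additive (Abelianization (commutator G))) :=
  QuotientGroup.lift (commutator G) (conjRep G) (commutator_le_ker_conjRep G)

end General

/-! ### Surface groups -/

section Surface

variable (g : ℕ)

/-- The (zero-based) index `2 * i` of the generator `x_{2i+1}`. -/
def oddIdx (i : Fin g) : Fin (2 * g) := ⟨2 * i, by omega⟩

/-- The (zero-based) index `2 * i + 1` of the generator `x_{2i+2}`. -/
def evenIdx (i : Fin g) : Fin (2 * g) := ⟨2 * i + 1, by omega⟩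

/-- The surface relator `[x₁, x₂] [x₃, x₄] ⋯ [x_{2g-1}, x_{2g}]`, `[x, y] = x⁻¹ y⁻¹ x y`, in the
free group on `2g` generators. -/
def surfaceRelator : FreeGroup (Fin (2 * g)) :=
  (List.ofFn fun i : Fin g =>
    (FreeGroup.of (oddIdx g i))⁻¹ * (FreeGroup.of (evenIdx g i))⁻¹ *
      FreeGroup.of (oddIdx g i) * FreeGroup.of (evenIdx g i)).prod

/-- The fundamental group of the closed oriented surface of genus `g`:
`⟨x₁, …, x_{2g} | [x₁, x₂] ⋯ [x_{2g-1}, x_{2g}]⟩`. -/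
abbrev SurfaceGroup : Type := PresentedGroup ({surfaceRelator g} : Set (FreeGroup (Fin (2 * g))))

/-- The lattice `ℤ^{2g}`. -/
abbrev Lattice : Type := Fin (2 * g) → ℤ

theorem lift_surfaceRelator {A : Type} [CommGroup A] (f : Fin (2 * g) → A) :
    FreeGroup.lift f (surfaceRelator g) = 1 := by
  rw [surfaceRelator, map_list_prod, List.map_ofFn]
  apply List.prod_eq_one
  intro x hx
  obtain ⟨i, rfl⟩ := (List.mem_ofFn' _ _).1 hx
  simp [mul_comm]

/-- The homomorphism `π₁(Σ_g)^ab → ℤ^{2g}` sending the class of `x_i` to the `i`-th standard basis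
vector. -/
def toLattice : Abelianization (SurfaceGroup g) →* Multiplicative (Lattice g) :=
  Abelianization.lift (PresentedGroup.toGroup
    (f := fun i => Multiplicative.ofAdd (Pi.single i (1 : ℤ) : Lattice g)) (by
      rintro r rfl
      exact lift_surfaceRelator g _))

/-- The homomorphism `ℤ^{2g} → π₁(Σ_g)^ab`, `v ↦ ∏ x_i ^ v_i`. -/
def ofLattice : Multiplicative (Lattice g) →* Abelianization (SurfaceGroup g) where
  toFun v := ∏ i, Abelianization.of (PresentedGroup.of i : SurfaceGroup g) ^ (v.toAdd i)
  map_one' := by simp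
  map_mul' v w := by simp [zpow_add, Finset.prod_mul_distrib]

/-- The isomorphism `π₁(Σ_g)^ab ≅ ℤ^{2g}` sending the class of `x_i` to the `i`-th standard basis
vector. -/
def abEquivLattice : Abelianization (SurfaceGroup g) ≃* Multiplicative (Lattice g) :=
  MonoidHom.toMulEquiv (toLattice g) (ofLattice g)
    (by
      apply Abelianization.hom_ext
      apply PresentedGroup.ext
      intro i
      simp only [MonoidHom.comp_apply, toLattice, Abelianization.lift_apply_of,
        PresentedGroup.toGroup.of, MonoidHom.id_apply]
      change ∏ j, _ ^ ((Pi.single i (1 : ℤ) : Lattice g) j) = _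
      rw [Finset.prod_eq_single i]
      · simp
      · intro j _ hj
        simp [Pi.single_eq_of_ne hj]
      · simp)
    (by
      refine MonoidHom.ext fun v => Multiplicative.toAdd.injective (funext fun i => ?_)
      change (toLattice g (∏ j, _ ^ (v.toAdd j))).toAdd i = v.toAdd i
      simp [toLattice, Finset.sum_apply, Pi.single_apply])

/-- The module `[π₁(Σ_g), π₁(Σ_g)]^ab`, as a representation of `ℤ^{2g} ≅ π₁(Σ_g)^ab`; the action
is induced by conjugation. -/
def surfaceRep : Representation ℤ (Multiplicative (Lattice g))
    (Additive (Abelianization (commutator (SurfaceGroup g)))) :=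
  (conjRepAb (SurfaceGroup g)).comp (abEquivLattice g).symm.toMonoidHom

/-- The element `e₁ ∧ e₂ + e₃ ∧ e₄ + ⋯ + e_{2g-1} ∧ e_{2g}` of `⋀² ℤ^{2g}`. -/
def omega : ⋀[ℤ]^2 (Lattice g) :=
  ∑ i : Fin g, exteriorPower.ιMulti ℤ 2
    ![(Pi.single (oddIdx g i) 1 : Lattice g), Pi.single (evenIdx g i) 1]

end Surface

end SurfaceCommutator

end

/-! Write R for the group ring of ℤ^n with n = 2g, and K for the kernel of R^n → R, e_i ↦ x_i - 1.
Fox derivatives of words in the commutator subgroup of the free group fill out K (`exists_fox_eq`).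
Passing to π kills exactly the R-multiples of the derivative of the relator r, which gives a short
exact sequence 0 → R → K → [π,π]^ab → 0 (`relatorMap_injective`, `exact_relatorMap_schreierMap`,
`schreierMap_surjective`).

The homology of K comes from dimension shifting along 0 → K → R^n → I → 0 and 0 → I → R → ℤ → 0,
where I is the augmentation ideal: H_k(K) ≅ H_{k+2}(ℤ^n; ℤ), free of rank C(n, k+2)
(`relRep_freeOfRank`). The homology of ℤ is found by killing one variable of R at a time: a group
element acts trivially on homology, so each long exact sequence breaks up and ranks obey Pascal's
rule (`ringRep_freeOfRank_succ`).

Since R has homology only in degree 0, what remains is the map H_0(R) = ℤ → H_0(K). A second-order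
Fox derivative, equal to -1 on r, splits it (`exists_retraction_relatorHomologyMap`). So H_0 of
[π,π]^ab is free of rank C(n,2) - 1, and its higher homology is that of K. The element ω is also
split in ⋀², so both sides of each claimed isomorphism are free of the same finite rank; the
isomorphisms are obtained by comparing ranks and no natural map is constructed. For g ≥ 2, H_1 has
rank C(2g,3) > 0, which excludes freeness. -/

noncomputable section

namespace SurfaceCommutator

/-! ### Ranks of finite free modules in short exact sequences -/

section Rank

variable {R : Type*} [CommRing R]
variable {A B C : Type*} [AddCommGroup A] [AddCommGroup B] [AddCommGroup C]
  [Module R A] [Module R B] [Module R C]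

variable (R A) in
/-- `A` is a finite free `R`-module of rank `r`. -/
structure FreeOfRank (r : ℕ) : Prop where
  free : Module.Free R A
  finite : Module.Finite R A
  finrank_eq : Module.finrank R A = r

theorem FreeOfRank.of_equiv {r : ℕ} (h : FreeOfRank R A r) (e : A ≃ₗ[R] B) : FreeOfRank R B r := by
  obtain ⟨_, _, h3⟩ := h
  exact ⟨.of_equiv e, .equiv e, by rw [← h3, e.finrank_eq]⟩

theorem FreeOfRank.nonempty_equiv [StrongRankCondition R] {r : ℕ} (h : FreeOfRank R A r)
    (h' : FreeOfRank R B r) :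
    Nonempty (A ≃ₗ[R] B) := by
  obtain ⟨_, _, h3⟩ := h
  obtain ⟨_, _, h4⟩ := h'
  exact ⟨LinearEquiv.ofFinrankEq A B (by rw [h3, h4])⟩

theorem FreeOfRank.prod [StrongRankCondition R] {r s : ℕ} (h : FreeOfRank R A r)
    (h' : FreeOfRank R B s) :
    FreeOfRank R (A × B) (r + s) := by
  obtain ⟨_, _, h3⟩ := h
  obtain ⟨_, _, h4⟩ := h'
  exact ⟨inferInstance, inferInstance, by rw [Module.finrank_prod, h3, h4]⟩

theorem FreeOfRank.of_subsingleton [Nontrivial R] [Subsingleton A] : FreeOfRank R A 0 :=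
  ⟨inferInstance, inferInstance, Module.finrank_zero_of_subsingleton⟩

theorem FreeOfRank.of_exact [StrongRankCondition R] {r s : ℕ}
    {f : A →ₗ[R] B} {g : B →ₗ[R] C} (hf : Function.Injective f)
    (hfg : Function.Exact f g) (hg : Function.Surjective g)
    (hA : FreeOfRank R A r) (hC : FreeOfRank R C s) : FreeOfRank R B (r + s) := by
  have := hC.free
  obtain ⟨l, hl⟩ := Module.projective_lifting_property g LinearMap.id hg
  obtain ⟨e, -⟩ := hfg.splitSurjectiveEquiv hf ⟨l, hl⟩
  exact (hA.prod hC).of_equiv e.symm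

/-- The retraction makes C a direct summand of B, hence projective, hence free over a PID. It also
forces r ≤ s, so the subtraction does not truncate. -/
theorem FreeOfRank.coker [IsDomain R] [IsPrincipalIdealRing R] {r s : ℕ}
    {f : A →ₗ[R] B} {g : B →ₗ[R] C} {l : B →ₗ[R] A}
    (hl : l ∘ₗ f = LinearMap.id)
    (hfg : Function.Exact f g) (hg : Function.Surjective g)
    (hA : FreeOfRank R A r) (hB : FreeOfRank R B s) : FreeOfRank R C (s - r) := by
  obtain ⟨e, -⟩ := hfg.splitInjectiveEquiv hg ⟨l, hl⟩
  obtain ⟨_, _, h3⟩ := hA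
  obtain ⟨_, _, h4⟩ := hB
  have hfin : Module.Finite R C := .of_surjective g hg
  have hfree : Module.Free R C := by
    have : Module.Projective R C := .of_split (e.symm.toLinearMap ∘ₗ LinearMap.inr R A C)
      (LinearMap.snd R A C ∘ₗ e.toLinearMap) (by ext; simp)
    infer_instance
  have h := e.finrank_eq
  rw [Module.finrank_prod, h3, h4] at h
  exact ⟨hfree, hfin, by omega⟩

end Rank

/-! ### Group homology of short exact sequences and projective representations -/

section Homology

open CategoryTheory Representation

variable {k G : Type} [CommRing k] [Group G]

/-- P is a retract of the module induced from the trivial subgroup, whose higher homology vanishes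
by Shapiro's lemma. -/
theorem isZero_groupHomology_of_projective (P : Rep.{0} k G) [Projective P] (n : ℕ) :
    Limits.IsZero (groupHomology P (n + 1)) := by
  classical
  let X : Rep k (⊥ : Subgroup G) := Rep.res (⊥ : Subgroup G).subtype P
  let p : Rep.ind (⊥ : Subgroup G).subtype X ⟶ P :=
    (Rep.indResHomEquiv (⊥ : Subgroup G).subtype X P).symm (𝟙 X)
  have hp : Epi p := by
    rw [Rep.epi_iff_surjective]
    intro x
    refine ⟨IndV.mk _ _ 1 x, ?_⟩
    have h : ((Rep.indResHomEquiv (⊥ : Subgroup G).subtype X P) p).hom x = (𝟙 X : X ⟶ X).hom x := by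
      rw [LinearEquiv.apply_symm_apply]
    exact h
  have h0 : Limits.IsZero ((groupHomology.functor k G (n + 1)).obj
      (Rep.ind (⊥ : Subgroup G).subtype X)) :=
    (isZero_groupHomology_succ_of_subsingleton X n).of_iso (groupHomology.indIso _ X (n + 1))
  have hs : (groupHomology.functor k G (n + 1)).map (Projective.factorThru (𝟙 P) p) ≫
      (groupHomology.functor k G (n + 1)).map p = 𝟙 _ := by
    rw [← Functor.map_comp, Projective.factorThru_comp, CategoryTheory.Functor.map_id]
  rw [Limits.IsZero.iff_id_eq_zero]
  change 𝟙 ((groupHomology.functor k G (n + 1)).obj P) = 0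
  rw [← hs,
    h0.eq_of_tgt ((groupHomology.functor k G (n + 1)).map (Projective.factorThru (𝟙 P) p)) 0,
    Limits.zero_comp]

theorem isZero_groupHomology_of_free {V : Type} [AddCommGroup V] [Module k V]
    (ρ : Representation k G V) [Module.Free (MonoidAlgebra k G) ρ.asModule] (n : ℕ) :
    Limits.IsZero (groupHomology (Rep.of ρ) (n + 1)) := by
  have hp : Projective (Rep.toModuleMonoidAlgebra.obj (Rep.of ρ)) :=
    ModuleCat.projective_of_free (Module.Free.chooseBasis (MonoidAlgebra k G) ρ.asModule)
  have : Projective (Rep.of ρ) :=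
    Rep.equivalenceModuleMonoidAlgebra.toAdjunction.projective_of_map_projective _ hp
  exact isZero_groupHomology_of_projective _ n

section Sequences

variable {X : ShortComplex (Rep.{0} k G)}

theorem exact_groupHomology_map (hX : X.ShortExact) (i : ℕ) :
    Function.Exact (groupHomology.map (MonoidHom.id G) X.f i).hom
      (groupHomology.map (MonoidHom.id G) X.g i).hom :=
  (ShortComplex.ShortExact.moduleCat_exact_iff_function_exact _).1
    (groupHomology.mapShortComplex₂_exact hX i)

theorem exact_groupHomology_δ_map (hX : X.ShortExact) (i : ℕ) :
    Function.Exact (groupHomology.δ hX (i + 1) i rfl).hom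
      (groupHomology.map (MonoidHom.id G) X.f i).hom :=
  (ShortComplex.ShortExact.moduleCat_exact_iff_function_exact _).1
    (groupHomology.mapShortComplex₁_exact hX rfl)

theorem exact_groupHomology_map_δ (hX : X.ShortExact) (i : ℕ) :
    Function.Exact (groupHomology.map (MonoidHom.id G) X.g (i + 1)).hom
      (groupHomology.δ hX (i + 1) i rfl).hom :=
  (ShortComplex.ShortExact.moduleCat_exact_iff_function_exact _).1
    (groupHomology.mapShortComplex₃_exact hX rfl)

theorem H0π_apply (A : Rep.{0} k G) (x : A) :
    (groupHomology.H0π A).hom x = (groupHomology.H0Iso A).inv.hom (Coinvariants.mk A.ρ x) :=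
  congr($(groupHomology.coinvariantsMk_comp_H0Iso_inv A) x).symm

theorem groupHomology_map_H0π {A B : Rep.{0} k G} (f : A ⟶ B) (x : A) :
    (groupHomology.map (MonoidHom.id G) f 0).hom ((groupHomology.H0π A).hom x) =
      (groupHomology.H0π B).hom (f.hom x) :=
  congr($(groupHomology.H0π_comp_map (MonoidHom.id G) f) x)

theorem surjective_groupHomology_map_zero {A B : Rep.{0} k G} (f : A ⟶ B)
    (hf : Function.Surjective f.hom) :
    Function.Surjective (groupHomology.map (MonoidHom.id G) f 0).hom := by
  intro y
  induction y using groupHomology.H0_induction_on with | _ y =>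
  obtain ⟨x, rfl⟩ := hf y
  exact ⟨groupHomology.H0π A x, groupHomology_map_H0π f x⟩

theorem groupHomology_map_zero_eq_zero {A B : Rep.{0} k G} (f : A ⟶ B)
    (hf : ∀ x, Coinvariants.mk B.ρ (f.hom x) = 0) :
    groupHomology.map (MonoidHom.id G) f 0 = 0 := by
  ext y
  induction y using groupHomology.H0_induction_on with | _ x =>
  refine (groupHomology_map_H0π f x).trans ?_
  rw [H0π_apply, hf, map_zero]
  rfl

theorem δ_naturality {Y : ShortComplex (Rep.{0} k G)} (hX : X.ShortExact) (hY : Y.ShortExact)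
    (φ : X ⟶ Y) (n : ℕ) :
    groupHomology.δ hX (n + 1) n rfl ≫ groupHomology.map (MonoidHom.id G) φ.τ₁ n =
      groupHomology.map (MonoidHom.id G) φ.τ₃ (n + 1) ≫ groupHomology.δ hY (n + 1) n rfl :=
  HomologicalComplex.HomologySequence.δ_naturality
    ((groupHomology.chainsFunctor k G).mapShortComplex.map φ)
    (groupHomology.map_chainsFunctor_shortExact hX)
    (groupHomology.map_chainsFunctor_shortExact hY) (n + 1) n rfl

/-- Degree 0 needs `h0` separately, because H_0 of the middle term is not assumed to vanish. -/
theorem δ_bijective (hX : X.ShortExact) (h2 : ∀ n, Limits.IsZero (groupHomology X.X₂ (n + 1)))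
    (h0 : groupHomology.map (MonoidHom.id G) X.f 0 = 0) (n : ℕ) :
    Function.Bijective (groupHomology.δ hX (n + 1) n rfl).hom := by
  constructor
  · have := groupHomology.mono_δ_of_isZero hX n (h2 n)
    exact (ModuleCat.mono_iff_injective _).1 this
  · intro y
    refine (exact_groupHomology_δ_map hX n y).1 ?_
    cases n with
    | zero => rw [h0]; rfl
    | succ n => rw [(h2 n).eq_of_tgt (groupHomology.map (MonoidHom.id G) X.f (n + 1)) 0]; rfl

/-- Dimension shifting. -/
theorem FreeOfRank.groupHomology_of_shortExact (hX : X.ShortExact)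
    (h2 : ∀ n, Limits.IsZero (groupHomology X.X₂ (n + 1)))
    (h0 : groupHomology.map (MonoidHom.id G) X.f 0 = 0) {n r : ℕ}
    (h : FreeOfRank k (groupHomology X.X₃ (n + 1)) r) : FreeOfRank k (groupHomology X.X₁ n) r :=
  h.of_equiv (LinearEquiv.ofBijective _ (δ_bijective hX h2 h0 n))

end Sequences

end Homology

/-! ### Triviality of the action on homology for commutative groups -/

section Central

open CategoryTheory Representation

variable {k G : Type} [CommRing k] [CommGroup G]

/-- An element of a commutative group acts trivially on the homology of a representation. -/
theorem groupHomology_map_applyAsHom (A : Rep.{0} k G) (g : G) (n : ℕ) :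
    groupHomology.map (MonoidHom.id G) (A.applyAsHom g) n = 𝟙 _ := by
  induction n generalizing A with
  | zero =>
    ext y
    induction y using groupHomology.H0_induction_on with | _ x =>
    refine (groupHomology_map_H0π _ x).trans ?_
    rw [H0π_apply, Rep.applyAsHom_apply, Coinvariants.mk_self_apply]
    exact (H0π_apply A x).symm
  | succ n ih =>
    -- Dimension shift along a projective cover of A: δ is injective and commutes with the action of
    -- g, so the claim in degree n for the kernel gives it in degree n + 1 for A.
    let X : ShortComplex (Rep.{0} k G) :=
      ShortComplex.mk (Limits.kernel.ι (Projective.π A)) (Projective.π A) (by simp)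
    have hX : X.ShortExact :=
      { exact := ShortComplex.exact_kernel _ }
    have hm : Mono (groupHomology.δ hX (n + 1) n rfl) :=
      groupHomology.mono_δ_of_isZero hX n (isZero_groupHomology_of_projective _ n)
    let φ : X ⟶ X :=
      { τ₁ := X.X₁.applyAsHom g
        τ₂ := X.X₂.applyAsHom g
        τ₃ := X.X₃.applyAsHom g
        comm₁₂ := Rep.applyAsHom_comm _ _
        comm₂₃ := Rep.applyAsHom_comm _ _ }
    have h := δ_naturality hX hX φ n
    change _ ≫ groupHomology.map (MonoidHom.id G) (X.X₁.applyAsHom g) n =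
      groupHomology.map (MonoidHom.id G) (A.applyAsHom g) (n + 1) ≫ _ at h
    rw [ih, Category.comp_id] at h
    rw [← cancel_mono (groupHomology.δ hX (n + 1) n rfl), ← h]
    exact (Category.id_comp _).symm

end Central

/-! ### Short exact sequences of representations from unbundled data -/

section RepComplex

open CategoryTheory Representation

variable {k G V₁ V₂ V₃ : Type} [CommRing k] [Group G] [AddCommGroup V₁] [Module k V₁]
  [AddCommGroup V₂] [Module k V₂] [AddCommGroup V₃] [Module k V₃]
  {ρ₁ : Representation k G V₁} {ρ₂ : Representation k G V₂} {ρ₃ : Representation k G V₃}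

/-- The short complex of representations given by composable intertwining maps. -/
abbrev repComplex (f : ρ₁.IntertwiningMap ρ₂) (g : ρ₂.IntertwiningMap ρ₃)
    (h : Function.Exact f g) : ShortComplex (Rep k G) :=
  ShortComplex.mk (Rep.ofHom f) (Rep.ofHom g) (by
    ext x
    exact h.apply_apply_eq_zero x)

theorem repComplex_shortExact {f : ρ₁.IntertwiningMap ρ₂} {g : ρ₂.IntertwiningMap ρ₃}
    (h : Function.Exact f g) (hf : Function.Injective f) (hg : Function.Surjective g) :
    (repComplex f g h).ShortExact where
  exact := by
    rw [← ShortComplex.exact_map_iff_of_faithful _ (forget₂ (Rep k G) (ModuleCat k))]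
    exact (ShortComplex.ShortExact.moduleCat_exact_iff_function_exact _).2 h
  mono_f := (Rep.mono_iff_injective _).2 hf
  epi_g := (Rep.epi_iff_surjective _).2 hg

end RepComplex

/-! ### Group rings as representations -/

section GroupRing

variable {k A B : Type} [CommRing k] [CommGroup A] [CommGroup B]

/-- If `B` is generated by `t` and the image of a section of `p : B → A`, where `p t = 1`, then the
kernel of `k[B] → k[A]` is generated by `t - 1`. -/
theorem mapDomain_ker_eq_span (p : B →* A) (s : A →* B) (t : B)
    (ht : p t = 1) (h : ∀ b, ∃ z : ℤ, b = s (p b) * t ^ z) :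
    RingHom.ker (MonoidAlgebra.mapDomainRingHom k p) =
      Ideal.span {MonoidAlgebra.single t 1 - 1} := by
  set I : Ideal (MonoidAlgebra k B) := Ideal.span {MonoidAlgebra.single t 1 - 1}
  apply le_antisymm
  · let q : B →* (MonoidAlgebra k B ⧸ I) := (Ideal.Quotient.mk I).toMonoidHom.comp
      (MonoidAlgebra.of k B)
    have hq : q t = 1 := by
      change Ideal.Quotient.mk I _ = Ideal.Quotient.mk I 1
      rw [Ideal.Quotient.eq]
      exact Ideal.subset_span rfl
    -- Modulo t - 1 the elements b and s (p b) agree, so the quotient map factors through k[B] →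
    -- k[A] and kills its kernel.
    have key : (Ideal.Quotient.mk I) = ((Ideal.Quotient.mk I).comp
        (MonoidAlgebra.mapDomainRingHom k s)).comp (MonoidAlgebra.mapDomainRingHom k p) := by
      ext b
      · simp
      · obtain ⟨z, hz⟩ := h b
        have h1 : q b = q (s (p b)) := by
          conv_lhs => rw [hz, map_mul, MonoidHom.mem_ker.1 (zpow_mem (MonoidHom.mem_ker.2 hq) z),
            mul_one]
        simpa [q] using h1
    intro x hx
    rw [RingHom.mem_ker] at hx
    rw [← Ideal.Quotient.eq_zero_iff_mem, key, RingHom.comp_apply, hx, map_zero]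
  · rw [Ideal.span_le, Set.singleton_subset_iff, SetLike.mem_coe, RingHom.mem_ker]
    rw [map_sub, map_one, sub_eq_zero, MonoidAlgebra.mapDomainRingHom_apply,
      MonoidAlgebra.mapDomain_single, ht, MonoidAlgebra.one_def]

end GroupRing

/-! ### Killing one variable of a group ring -/

section PermRep

open CategoryTheory Representation

variable {G A B : Type} [CommGroup G] [CommGroup A] [CommGroup B]

/-- The group ring `ℤ[B]` as a representation of `G` via a homomorphism `G → B`. -/
abbrev ringRep (φ : G →* B) : Representation ℤ G (MonoidAlgebra ℤ B) :=
  (leftRegular ℤ B).comp φ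

theorem ringRep_apply (φ : G →* B) (g : G) (x : MonoidAlgebra ℤ B) :
    ringRep φ g x = MonoidAlgebra.single (φ g) 1 * x := by
  induction x using MonoidAlgebra.induction_linear with
  | zero => simp
  | add x y hx hy => rw [map_add, hx, hy, mul_add]
  | single b r => simp [MonoidAlgebra.single_mul_single]

/-- The map `ℤ[B] → ℤ[A]` induced by `p : B → A`, as a map of representations. -/
def ringRepMap (φ : G →* B) (p : B →* A) :
    (ringRep φ).IntertwiningMap (ringRep (p.comp φ)) :=
  LinearMap.intertwiningMap_of_isIntertwiningMap _ _
    (MonoidAlgebra.mapDomainRingHom ℤ p).toAddMonoidHom.toIntLinearMap (by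
      intro g x
      simp only [ringRep_apply]
      change MonoidAlgebra.mapDomainRingHom ℤ p _ = _ * MonoidAlgebra.mapDomainRingHom ℤ p x
      rw [map_mul]
      simp)

theorem groupHomology_map_applyAsHom_sub (X : Rep.{0} ℤ G) (g : G) (n : ℕ) :
    groupHomology.map (MonoidHom.id G) (X.applyAsHom g - 𝟙 X) n = 0 := by
  have h : groupHomology.chainsMap (MonoidHom.id G) (X.applyAsHom g - 𝟙 X) =
      groupHomology.chainsMap (MonoidHom.id G) (X.applyAsHom g) -
        groupHomology.chainsMap (MonoidHom.id G) (𝟙 X) := by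
    ext n x : 3
    simp [Rep.sub_hom, LinearMap.comp_sub]
  rw [groupHomology.map, h, HomologicalComplex.homologyMap_sub]
  exact sub_eq_zero.2 ((groupHomology_map_applyAsHom X g n).trans (groupHomology.map_id n).symm)

/-- With t = φ g, the sequence 0 → ℤ[B] → ℤ[B] → ℤ[A] → 0 has multiplication by t - 1 as its first
map. This is the action of g minus the identity, so it is zero on homology, and the long exact
sequence breaks into 0 → H_{n+1}(ℤ[B]) → H_{n+1}(ℤ[A]) → H_n(ℤ[B]) → 0. -/
theorem ringRep_freeOfRank_succ (φ : G →* B) [NoZeroDivisors (MonoidAlgebra ℤ B)]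
    (p : B →* A) (s : A →* B) (g : G)
    (hs : ∀ a, p (s a) = a) (hg : φ g ≠ 1) (hp : p (φ g) = 1)
    (h : ∀ b, ∃ z : ℤ, b = s (p b) * φ g ^ z) {r : ℕ → ℕ}
    (H : ∀ n, FreeOfRank ℤ (groupHomology (Rep.of (ringRep φ)) n) (r n)) :
    FreeOfRank ℤ (groupHomology (Rep.of (ringRep (p.comp φ))) 0) (r 0) ∧
    ∀ n, FreeOfRank ℤ (groupHomology (Rep.of (ringRep (p.comp φ))) (n + 1)) (r (n + 1) + r n) := by
  let f : (Rep.of (ringRep φ)) ⟶ (Rep.of (ringRep φ)) :=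
    (Rep.of (ringRep φ)).applyAsHom g - 𝟙 (Rep.of (ringRep φ))
  have hf (x) : f.hom x = (MonoidAlgebra.single (φ g) 1 - 1) * x := by
    rw [sub_mul, one_mul, ← ringRep_apply]
    rfl
  have hk := mapDomain_ker_eq_span (k := ℤ) p s (φ g) hp h
  have hex : Function.Exact f.hom (ringRepMap φ p) := by
    intro x
    change x ∈ RingHom.ker (MonoidAlgebra.mapDomainRingHom ℤ p) ↔ _
    rw [hk, Ideal.mem_span_singleton']
    constructor
    · rintro ⟨y, rfl⟩
      exact ⟨y, by rw [hf, mul_comm]⟩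
    · rintro ⟨y, rfl⟩
      exact ⟨y, by rw [hf, mul_comm]⟩
  have hX := repComplex_shortExact hex (by
      intro x y hxy
      rw [hf, hf] at hxy
      refine mul_left_cancel₀ ?_ hxy
      rw [sub_ne_zero, MonoidAlgebra.one_def, Ne, MonoidAlgebra.single_left_inj one_ne_zero]
      exact hg) (by
      intro x
      refine ⟨MonoidAlgebra.mapDomainRingHom ℤ s x, ?_⟩
      change MonoidAlgebra.mapDomainRingHom ℤ p _ = _
      rw [← RingHom.comp_apply, ← MonoidAlgebra.mapDomainRingHom_comp,
        show p.comp s = MonoidHom.id A from MonoidHom.ext hs, MonoidAlgebra.mapDomainRingHom_id]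
      rfl)
  set X := repComplex f.hom (ringRepMap φ p) hex
  have h0 (n) : groupHomology.map (MonoidHom.id G) X.f n = 0 :=
    groupHomology_map_applyAsHom_sub _ g n
  have inj (n) : Function.Injective (groupHomology.map (MonoidHom.id G) (A := X.X₂) (B := X.X₃)
      X.g n).hom := by
    rw [injective_iff_map_eq_zero]
    intro x hx
    obtain ⟨y, rfl⟩ := (exact_groupHomology_map hX n x).1 hx
    rw [h0]
    rfl
  have surj : Function.Surjective (groupHomology.map (MonoidHom.id G) (A := X.X₂) (B := X.X₃)
      X.g 0).hom :=
    surjective_groupHomology_map_zero _ ((Rep.epi_iff_surjective _).1 hX.epi_g)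
  constructor
  · exact (H 0).of_equiv (LinearEquiv.ofBijective _ ⟨inj 0, surj⟩)
  · intro n
    refine FreeOfRank.of_exact (inj (n + 1)) (exact_groupHomology_map_δ hX n) ?_ (H (n + 1)) (H n)
    intro y
    refine (exact_groupHomology_δ_map hX n y).1 ?_
    rw [h0]
    rfl

end PermRep

/-! ### The augmentation and the homology of `ℤ` -/

section Trivial

open CategoryTheory Representation

variable {G : Type} [CommGroup G]

/-- The augmentation `ℤ[G] → ℤ`. -/
def augmentation (G : Type) [CommGroup G] :
    (leftRegular ℤ G).IntertwiningMap (Representation.trivial ℤ G ℤ) :=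
  LinearMap.intertwiningMap_of_isIntertwiningMap _ _
    (MonoidAlgebra.lift ℤ ℤ G 1).toLinearMap (by
      intro g x
      change MonoidAlgebra.lift ℤ ℤ G 1 _ = MonoidAlgebra.lift ℤ ℤ G 1 x
      induction x using MonoidAlgebra.induction_linear with
      | zero => simp
      | add x y hx hy => rw [map_add, map_add, hx, hy, map_add]
      | single b r => simp)

theorem augmentation_eq_lift (x : MonoidAlgebra ℤ G) :
    augmentation G x = MonoidAlgebra.lift ℤ ℤ G 1 x := rfl

@[simp]
theorem augmentation_single (g : G) (r : ℤ) :
    augmentation G (MonoidAlgebra.single g r) = r := by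
  simp [augmentation_eq_lift]

theorem augmentation_mul (x y : MonoidAlgebra ℤ G) :
    augmentation G (x * y) = augmentation G x * augmentation G y := by
  simp [augmentation_eq_lift]

theorem augmentation_surjective : Function.Surjective (augmentation G) :=
  fun r => ⟨MonoidAlgebra.single 1 r, augmentation_single 1 r⟩

theorem coinvariants_mk_leftRegular (x : MonoidAlgebra ℤ G) :
    Coinvariants.mk (leftRegular ℤ G) x =
      Coinvariants.mk (leftRegular ℤ G) (MonoidAlgebra.single 1 (augmentation G x)) := by
  induction x using MonoidAlgebra.induction_linear with
  | zero => simp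
  | add x y hx hy => rw [map_add, hx, hy, ← map_add, ← MonoidAlgebra.single_add, ← map_add]
  | single g r =>
    rw [augmentation_single, ← Coinvariants.mk_self_apply _ g (MonoidAlgebra.single 1 r)]
    simp

theorem freeOfRank_groupHomology_zero_trivial :
    FreeOfRank ℤ (groupHomology (Rep.of (Representation.trivial ℤ G ℤ)) 0) 1 := by
  have h : FreeOfRank ℤ ℤ 1 := ⟨inferInstance, inferInstance, Module.finrank_self ℤ⟩
  exact h.of_equiv
    (groupHomology.H0IsoOfIsTrivial (Rep.trivial ℤ G ℤ)).symm.toLinearEquiv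

theorem bijective_groupHomology_map_augmentation :
    Function.Bijective
      (groupHomology.map (MonoidHom.id G) (A := Rep.of (leftRegular ℤ G))
        (B := Rep.of (Representation.trivial ℤ G ℤ)) (Rep.ofHom (augmentation G)) 0).hom := by
  refine ⟨?_, surjective_groupHomology_map_zero _ augmentation_surjective⟩
  rw [injective_iff_map_eq_zero]
  intro y hy
  induction y using groupHomology.H0_induction_on with | _ x =>
  have h1 := (groupHomology_map_H0π (Rep.ofHom (augmentation G)) x).symm.trans hy
  have h2 : augmentation G x = 0 := by
    have h3 := (groupHomology.H0IsoOfIsTrivial (Rep.trivial ℤ G ℤ)).symm.toLinearEquiv.injective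
    exact h3 (h1.trans (map_zero _).symm)
  refine (H0π_apply _ _).trans ?_
  change (groupHomology.H0Iso (Rep.of (leftRegular ℤ G))).inv.hom
    (Coinvariants.mk (leftRegular ℤ G) x) = _
  rw [coinvariants_mk_leftRegular, h2, MonoidAlgebra.single_zero, map_zero, map_zero]

theorem freeOfRank_groupHomology_zero_leftRegular :
    FreeOfRank ℤ (groupHomology (Rep.of (leftRegular ℤ G)) 0) 1 :=
  freeOfRank_groupHomology_zero_trivial.of_equiv
    (LinearEquiv.ofBijective _ bijective_groupHomology_map_augmentation).symm

end Trivial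

/-! ### The homology of ℤ^n with trivial coefficients -/

section FreeAbelian

open CategoryTheory Representation

variable {G : Type} [CommGroup G]

/-- The homomorphism `ℤ^(j+1) → ℤ^j` forgetting the first coordinate. -/
def latticeTail (j : ℕ) : Multiplicative (Fin (j + 1) → ℤ) →* Multiplicative (Fin j → ℤ) :=
  (LinearMap.funLeft ℤ ℤ (Fin.succ : Fin j → Fin (j + 1))).toAddMonoidHom.toMultiplicative

/-- The homomorphism `ℤ^j → ℤ^(j+1)` inserting a zero as first coordinate. -/
def latticeCons (j : ℕ) : Multiplicative (Fin j → ℤ) →* Multiplicative (Fin (j + 1) → ℤ) :=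
  AddMonoidHom.toMultiplicative
    { toFun v := Fin.cons 0 v
      map_zero' := by ext i; refine Fin.cases ?_ (fun i => ?_) i <;> simp
      map_add' v w := by ext i; refine Fin.cases ?_ (fun i => ?_) i <;> simp }

/-- Each of the j variables killed raises m by one, by Pascal's rule. The group ring of ℤ^0 at the
end is ℤ with trivial action. -/
theorem ringRep_freeOfRank (j m : ℕ) (φ : G →* Multiplicative (Fin j → ℤ))
    (hφ : Function.Surjective φ)
    (H : ∀ n, FreeOfRank ℤ (groupHomology (Rep.of (ringRep φ)) n) (m.choose n))
    (ψ : G →* Multiplicative (Fin 0 → ℤ)) (n : ℕ) :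
    FreeOfRank ℤ (groupHomology (Rep.of (ringRep ψ)) n) ((m + j).choose n) := by
  induction j generalizing m with
  | zero =>
    obtain rfl : φ = ψ := MonoidHom.ext fun _ => Subsingleton.elim _ _
    exact H n
  | succ j ih =>
    obtain ⟨g, hg⟩ := hφ (Multiplicative.ofAdd (Pi.single 0 1))
    have hs : ∀ a, latticeTail j (latticeCons j a) = a := fun a => rfl
    have hstep := ringRep_freeOfRank_succ φ (latticeTail j) (latticeCons j) g hs
      (by
        rw [hg]
        intro h
        have := congr_fun (congr_arg Multiplicative.toAdd h) 0
        simp at this)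
      (by
        rw [hg]
        apply Multiplicative.toAdd.injective
        ext i
        simp [latticeTail, LinearMap.funLeft_apply])
      (by
        intro b
        refine ⟨b.toAdd 0, ?_⟩
        rw [hg]
        apply Multiplicative.toAdd.injective
        ext i
        refine Fin.cases ?_ (fun i => ?_) i
        · simp [latticeTail, latticeCons]
        · simp [latticeTail, latticeCons, LinearMap.funLeft_apply]) H
    rw [← add_right_comm m 1 j |>.trans (by ring : m + j + 1 = m + (j + 1))]
    refine ih (m + 1) ((latticeTail j).comp φ)
      ((Function.RightInverse.surjective hs).comp hφ) (fun n => ?_)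
    cases n with
    | zero => simpa using hstep.1
    | succ n => rw [Nat.choose_succ_succ, Nat.add_comm (m.choose n)]; exact hstep.2 n

theorem groupHomology_trivial_freeOfRank (n k : ℕ) :
    FreeOfRank ℤ (groupHomology (Rep.of
      (Representation.trivial ℤ (Multiplicative (Fin n → ℤ)) ℤ)) k) (n.choose k) := by
  -- The starting point is m = 0: the regular representation has homology ℤ in degree 0 only, and
  -- C(0, k) records this.
  have h0 : ∀ k, FreeOfRank ℤ (groupHomology (Rep.of
      (ringRep (MonoidHom.id (Multiplicative (Fin n → ℤ))))) k) (Nat.choose 0 k) := by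
    intro k
    cases k with
    | zero => exact freeOfRank_groupHomology_zero_leftRegular
    | succ k =>
      have h := isZero_groupHomology_of_projective
        (Rep.leftRegular ℤ (Multiplicative (Fin n → ℤ))) k
      have := ModuleCat.subsingleton_of_isZero h
      exact FreeOfRank.of_subsingleton
  have h1 := ringRep_freeOfRank n 0 _ Function.surjective_id h0 1 k
  rw [zero_add] at h1
  let e : MonoidAlgebra ℤ (Multiplicative (Fin 0 → ℤ)) ≃ₗ[ℤ] ℤ :=
    (MonoidAlgebra.uniqueRingEquiv (R := ℤ)
      (Multiplicative (Fin 0 → ℤ))).toAddEquiv.toIntLinearEquiv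
  exact h1.of_equiv (groupHomology.mapIso (MulEquiv.refl _)
    (A := Rep.of (ringRep (1 : Multiplicative (Fin n → ℤ) →* _)))
    (B := Rep.of (Representation.trivial ℤ (Multiplicative (Fin n → ℤ)) ℤ)) e (by
      intro g
      ext x
      simp) k).toLinearEquiv

end FreeAbelian

/-! ### The elements `x_i - 1` of the group ring of `ℤ^n` -/

section Koszul

open CategoryTheory Representation

variable (n : ℕ)

/-- The group ring of `ℤ^n`. -/
abbrev LatticeRing : Type := MonoidAlgebra ℤ (Multiplicative (Fin n → ℤ))

variable {n}

/-- The `i`-th variable of the group ring of `ℤ^n`. -/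
def latticeVar (i : Fin n) : LatticeRing n :=
  MonoidAlgebra.single (Multiplicative.ofAdd (Pi.single i 1)) 1

theorem free_apply (g : Multiplicative (Fin n → ℤ)) (v : Fin n →₀ LatticeRing n) :
    Representation.free ℤ (Multiplicative (Fin n → ℤ)) (Fin n) g v =
      (MonoidAlgebra.single g 1 : LatticeRing n) • v := by
  induction v using Finsupp.induction_linear with
  | zero => simp
  | add x y hx hy => rw [map_add, hx, hy, smul_add]
  | single i x =>
    rw [finsupp_single, Finsupp.smul_single]
    congr 1
    exact ringRep_apply (MonoidHom.id _) g x

/-- The linear map `e_i ↦ x_i - 1` over the group ring. -/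
def koszulLin : (Fin n →₀ LatticeRing n) →ₗ[LatticeRing n] LatticeRing n :=
  Finsupp.linearCombination _ fun i => latticeVar i - 1

/-- The map `e_i ↦ x_i - 1`, as a map of representations. -/
def koszul : (Representation.free ℤ (Multiplicative (Fin n → ℤ)) (Fin n)).IntertwiningMap
    (leftRegular ℤ (Multiplicative (Fin n → ℤ))) :=
  LinearMap.intertwiningMap_of_isIntertwiningMap _ _ (koszulLin.restrictScalars ℤ) (by
    intro g v
    rw [free_apply]
    exact (map_smul koszulLin _ v).trans (ringRep_apply (MonoidHom.id _) g _).symm)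

end Koszul

/-! ### Fox calculus -/

section Fox

open CategoryTheory Representation

variable {n : ℕ}

/-- The abelianization of the free group. -/
def freeAb (n : ℕ) : FreeGroup (Fin n) →* Multiplicative (Fin n → ℤ) :=
  FreeGroup.lift fun i => Multiplicative.ofAdd (Pi.single i 1)

@[simp]
theorem freeAb_of (i : Fin n) :
    freeAb n (FreeGroup.of i) = Multiplicative.ofAdd (Pi.single i 1) := by
  simp [freeAb]

theorem freeAb_surjective : Function.Surjective (freeAb n) := by
  rw [← MonoidHom.range_eq_top, Subgroup.eq_top_iff']
  intro v
  have h : v = ∏ i, (Multiplicative.ofAdd (Pi.single i 1 : Fin n → ℤ)) ^ (v.toAdd i) := by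
    apply Multiplicative.toAdd.injective
    ext j
    simp [Finset.sum_apply, Pi.single_apply]
  rw [h]
  exact Subgroup.prod_mem _ fun i _ =>
    zpow_mem (MonoidHom.mem_range.2 ⟨FreeGroup.of i, freeAb_of i⟩) _

/-- A set-theoretic section of the abelianization of the free group. -/
def freeSec : Multiplicative (Fin n → ℤ) → FreeGroup (Fin n) :=
  Function.surjInv freeAb_surjective

@[simp]
theorem freeAb_freeSec (a : Multiplicative (Fin n → ℤ)) : freeAb n (freeSec a) = a :=
  Function.surjInv_eq freeAb_surjective a

/-- A group element as an element of the group ring. -/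
abbrev latticeOf (a : Multiplicative (Fin n → ℤ)) : LatticeRing n := MonoidAlgebra.single a 1

theorem latticeOf_mul (a b : Multiplicative (Fin n → ℤ)) :
    latticeOf (a * b) = latticeOf a * latticeOf b := by
  simp [MonoidAlgebra.single_mul_single]

theorem latticeOf_one : latticeOf (1 : Multiplicative (Fin n → ℤ)) = 1 := rfl

/-- The affine action of the free group on the free module, `x_i v = e_i + x_i • v`. -/
def foxHom : FreeGroup (Fin n) →* Equiv.Perm (Fin n →₀ LatticeRing n) :=
  FreeGroup.lift fun i =>
    { toFun v := Finsupp.single i 1 + latticeOf (Multiplicative.ofAdd (Pi.single i 1)) • v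
      invFun v := latticeOf (Multiplicative.ofAdd (Pi.single i 1))⁻¹ • (v - Finsupp.single i 1)
      left_inv v := by
        simp only []
        rw [add_sub_cancel_left, ← mul_smul, ← latticeOf_mul, inv_mul_cancel, latticeOf_one,
          one_smul]
      right_inv v := by
        simp only []
        rw [← mul_smul, ← latticeOf_mul, mul_inv_cancel, latticeOf_one, one_smul, add_sub_cancel] }

/-- The Fox derivative. -/
def fox (w : FreeGroup (Fin n)) : Fin n →₀ LatticeRing n := foxHom w 0

theorem foxHom_apply (w : FreeGroup (Fin n)) (v : Fin n →₀ LatticeRing n) :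
    foxHom w v = fox w + latticeOf (freeAb n w) • v := by
  unfold fox
  induction w using FreeGroup.induction_on generalizing v with
  | C1 => simp [latticeOf_one]
  | of i => simp [foxHom]
  | inv_of i ih =>
    apply (foxHom (FreeGroup.of i)).injective
    have h := ih (foxHom (FreeGroup.of i)⁻¹ 0)
    rw [← Equiv.Perm.mul_apply, ← map_mul, mul_inv_cancel, map_one, Equiv.Perm.one_apply] at h
    rw [← Equiv.Perm.mul_apply, ← map_mul, mul_inv_cancel, map_one, Equiv.Perm.one_apply, ih,
      smul_add, ← add_assoc, ← h, zero_add, ← mul_smul, ← latticeOf_mul, ← map_mul,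
      mul_inv_cancel, map_one, latticeOf_one, one_smul]
  | mul w w' ih ih' =>
    rw [map_mul, Equiv.Perm.mul_apply, Equiv.Perm.mul_apply, ih, ih', ih (foxHom w' 0), map_mul,
      latticeOf_mul, smul_add, mul_smul, add_assoc]

@[simp]
theorem fox_one : fox (1 : FreeGroup (Fin n)) = 0 := by simp [fox]

@[simp]
theorem fox_of (i : Fin n) : fox (FreeGroup.of i) = Finsupp.single i 1 := by simp [fox, foxHom]

/-- The crossed homomorphism rule is the translation part of a composite of two affine maps. -/
theorem fox_mul (w w' : FreeGroup (Fin n)) :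
    fox (w * w') = fox w + latticeOf (freeAb n w) • fox w' := by
  rw [fox, map_mul, Equiv.Perm.mul_apply, foxHom_apply]
  rfl

theorem fox_inv (w : FreeGroup (Fin n)) :
    fox w⁻¹ = -(latticeOf (freeAb n w)⁻¹ • fox w) := by
  have h := fox_mul w⁻¹ w
  rw [inv_mul_cancel, fox_one, map_inv] at h
  exact eq_neg_of_add_eq_zero_left h.symm

/-- The fundamental formula of Fox calculus; it shows that words in the commutator subgroup have
derivatives in K. -/
theorem koszul_fox (w : FreeGroup (Fin n)) : koszulLin (fox w) = latticeOf (freeAb n w) - 1 := by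
  induction w using FreeGroup.induction_on with
  | C1 => simp [latticeOf_one]
  | of i =>
    rw [fox_of, freeAb_of]
    simp [koszulLin, latticeVar]
  | inv_of i ih =>
    rw [fox_inv, map_neg, map_smul, ih, smul_eq_mul, mul_sub, ← latticeOf_mul, inv_mul_cancel,
      latticeOf_one, mul_one, map_inv, neg_sub]
  | mul w w' ih ih' =>
    rw [fox_mul, map_add, map_smul, ih, ih', map_mul, latticeOf_mul, smul_eq_mul]
    ring

theorem augmentation_fox (w : FreeGroup (Fin n)) (i : Fin n) :
    augmentation _ (fox w i) = (freeAb n w).toAdd i := by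
  induction w using FreeGroup.induction_on with
  | C1 => simp
  | of j =>
    rw [fox_of, freeAb_of, Finsupp.single_apply, toAdd_ofAdd, Pi.single_apply]
    simp only [eq_comm (a := j)]
    split_ifs
    · rw [MonoidAlgebra.one_def, augmentation_single]
    · exact map_zero _
  | inv_of j ih =>
    rw [fox_inv, Finsupp.neg_apply, Finsupp.smul_apply, map_neg, smul_eq_mul, augmentation_mul,
      augmentation_single, ih]
    simp
  | mul w w' ih ih' =>
    rw [fox_mul, Finsupp.add_apply, Finsupp.smul_apply, map_add, smul_eq_mul, augmentation_mul,
      augmentation_single, ih, ih']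
    simp

/-- Every relation among the `x_i - 1` is the Fox derivative of an element of the commutator
subgroup. -/
theorem exists_fox_eq (v : Fin n →₀ LatticeRing n) (hv : koszulLin v = 0) :
    ∃ w, freeAb n w = 1 ∧ fox w = v := by
  let S : Submodule ℤ (Fin n →₀ LatticeRing n) := AddSubgroup.toIntSubmodule
    { carrier := {v | ∃ w, freeAb n w = 1 ∧ fox w = v}
      zero_mem' := ⟨1, map_one _, fox_one⟩
      add_mem' := by
        rintro _ _ ⟨w, hw, rfl⟩ ⟨w', hw', rfl⟩
        exact ⟨w * w', by rw [map_mul, hw, hw', mul_one],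
          by rw [fox_mul, hw, latticeOf_one, one_smul]⟩
      neg_mem' := by
        rintro _ ⟨w, hw, rfl⟩
        exact ⟨w⁻¹, by rw [map_inv, hw, inv_one],
          by rw [fox_inv, hw, inv_one, latticeOf_one, one_smul]⟩ }
  let σ : LatticeRing n →ₗ[ℤ] (Fin n →₀ LatticeRing n) ⧸ S :=
    Finsupp.linearCombination ℤ (fun a => S.mkQ (fox (freeSec a))) ∘ₗ
      (MonoidAlgebra.coeffLinearEquiv ℤ).toLinearMap
  have hσ (a r) : σ (MonoidAlgebra.single a r) = r • S.mkQ (fox (freeSec a)) := by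
    simp [σ]
  -- Words with the same abelianization have derivatives that agree modulo S, so σ may use any lift.
  -- The quotient map by S then factors through `koszulLin`, whose kernel must lie in S.
  have key (v) : S.mkQ v = σ (koszulLin v) := by
    induction v using Finsupp.induction_linear with
    | zero => simp
    | add x y hx hy => rw [map_add, hx, hy, map_add, map_add]
    | single i x =>
      induction x using MonoidAlgebra.induction_linear with
      | zero => simp
      | add x y hx hy => rw [Finsupp.single_add, map_add, hx, hy, map_add, map_add]
      | single a r =>
        set b := a * Multiplicative.ofAdd (Pi.single i 1)
        have h1 : koszulLin (Finsupp.single i (MonoidAlgebra.single a r)) =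
            MonoidAlgebra.single b r - MonoidAlgebra.single a r := by
          simp [koszulLin, latticeVar, mul_sub, MonoidAlgebra.single_mul_single, b]
        have h2 : fox (freeSec a * FreeGroup.of i) =
            fox (freeSec a) + Finsupp.single i (MonoidAlgebra.single a 1) := by
          rw [fox_mul, fox_of, freeAb_freeSec, Finsupp.smul_single, smul_eq_mul, mul_one]
        have h3 : S.mkQ (fox (freeSec a * FreeGroup.of i)) =
            S.mkQ (fox (freeSec b)) := by
          have hk : freeAb n (freeSec a * FreeGroup.of i * (freeSec b)⁻¹) = 1 := by
            simp [b]
          have h4 : freeSec a * FreeGroup.of i =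
            (freeSec a * FreeGroup.of i * (freeSec b)⁻¹) * freeSec b := by group
          rw [h4, fox_mul, hk, latticeOf_one, one_smul, map_add, add_eq_right]
          exact (Submodule.Quotient.mk_eq_zero S).2 ⟨_, hk, rfl⟩
        rw [h2, map_add] at h3
        rw [h1, map_sub, hσ, hσ, ← smul_sub, ← h3, add_sub_cancel_left, ← map_smul,
          Finsupp.smul_single, MonoidAlgebra.smul_single, smul_eq_mul, mul_one]
  have h := key v
  rw [hv, map_zero] at h
  exact (Submodule.Quotient.mk_eq_zero S).1 h

end Fox

/-! ### The homology of the module of relations among the `x_i - 1` -/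

section KoszulHomology

open CategoryTheory Representation

variable {n : ℕ}

section Ker

variable {k G V W : Type} [CommRing k] [Group G] [AddCommGroup V] [Module k V]
  [AddCommGroup W] [Module k W] {ρ : Representation k G V} {σ : Representation k G W}

/-- The kernel of an intertwining map, as a representation. -/
abbrev kerRep (f : ρ.IntertwiningMap σ) : Representation k G f.ker.toSubmodule :=
  f.ker.toRepresentation

/-- The kernel of an intertwining map, as an object of the category of representations. -/
abbrev kerObj (f : ρ.IntertwiningMap σ) : Rep k G := Rep.of (kerRep f)

/-- The inclusion of the kernel of an intertwining map. -/
def kerIncl (f : ρ.IntertwiningMap σ) : (kerRep f).IntertwiningMap ρ :=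
  LinearMap.intertwiningMap_of_isIntertwiningMap _ _ f.ker.toSubmodule.subtype fun _ _ => rfl

theorem kerIncl_injective (f : ρ.IntertwiningMap σ) : Function.Injective (kerIncl f) :=
  Subtype.val_injective

end Ker

theorem augmentation_koszul (v : Fin n →₀ LatticeRing n) :
    augmentation _ (koszulLin v) = 0 := by
  induction v using Finsupp.induction_linear with
  | zero => simp
  | add x y hx hy => rw [map_add, map_add, hx, hy, add_zero]
  | single i x =>
    rw [koszulLin, Finsupp.linearCombination_single, smul_eq_mul, augmentation_mul, map_sub,
      latticeVar, augmentation_single, MonoidAlgebra.one_def, augmentation_single, sub_self,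
      mul_zero]

/-- The elements x_i - 1 generate the augmentation ideal: a - 1 is the image of the Fox derivative
of any word lifting a. -/
theorem exists_koszul_eq (x : LatticeRing n) :
    ∃ v, koszulLin v = x - MonoidAlgebra.single 1 (augmentation _ x) := by
  induction x using MonoidAlgebra.induction_linear with
  | zero => exact ⟨0, by simp⟩
  | add x y hx hy =>
    obtain ⟨v, hv⟩ := hx
    obtain ⟨w, hw⟩ := hy
    exact ⟨v + w, by rw [map_add, map_add, hv, hw, MonoidAlgebra.single_add]; abel⟩
  | single a r =>
    refine ⟨r • fox (freeSec a), ?_⟩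
    rw [map_zsmul, koszul_fox, freeAb_freeSec, augmentation_single, smul_sub,
      MonoidAlgebra.smul_single, MonoidAlgebra.one_def, MonoidAlgebra.smul_single, smul_eq_mul,
      mul_one]

/-- The augmentation ideal as a representation. -/
abbrev augRep (n : ℕ) := kerRep (augmentation (Multiplicative (Fin n → ℤ)))

/-- The module of relations among the elements `x_i - 1`, as a representation. -/
abbrev relRep (n : ℕ) := kerRep (koszul (n := n))

/-- The map `e_i ↦ x_i - 1` onto the augmentation ideal. -/
def koszulAug : (Representation.free ℤ (Multiplicative (Fin n → ℤ)) (Fin n)).IntertwiningMap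
    (augRep n) :=
  LinearMap.intertwiningMap_of_isIntertwiningMap _ _
    ((koszul (n := n)).toLinearMap.codRestrict _ augmentation_koszul) (by
      intro g v
      exact Subtype.ext (IntertwiningMap.isIntertwining _ _ koszul g v))

theorem exact_kerIncl_koszulAug : Function.Exact (kerIncl (koszul (n := n))) koszulAug := by
  intro v
  constructor
  · intro h
    exact ⟨⟨v, congr_arg Subtype.val h⟩, rfl⟩
  · rintro ⟨w, rfl⟩
    exact Subtype.ext w.2

theorem koszulAug_surjective : Function.Surjective (koszulAug (n := n)) := by
  rintro ⟨x, hx⟩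
  obtain ⟨v, hv⟩ := exists_koszul_eq x
  refine ⟨v, Subtype.ext (hv.trans ?_)⟩
  rw [show augmentation _ x = 0 from hx, MonoidAlgebra.single_zero, sub_zero]

theorem exact_kerIncl_augmentation :
    Function.Exact (kerIncl (augmentation (Multiplicative (Fin n → ℤ)))) (augmentation _) := by
  intro v
  exact ⟨fun h => ⟨⟨v, h⟩, rfl⟩, by rintro ⟨w, rfl⟩; exact w.2⟩

theorem coinvariants_mk_free (v : Fin n →₀ LatticeRing n) (hv : ∀ i, augmentation _ (v i) = 0) :
    Coinvariants.mk (Representation.free ℤ (Multiplicative (Fin n → ℤ)) (Fin n)) v = 0 := by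
  rw [← Finsupp.sum_single v, Finsupp.sum, map_sum]
  refine Finset.sum_eq_zero fun i _ => ?_
  have h (x : LatticeRing n) : Coinvariants.mk (Representation.free ℤ _ (Fin n))
      (Finsupp.single i x) = Coinvariants.mk _
        (Finsupp.single i (MonoidAlgebra.single 1 (augmentation _ x))) := by
    induction x using MonoidAlgebra.induction_linear with
    | zero => simp
    | add x y hx hy =>
      rw [Finsupp.single_add, map_add, hx, hy, ← map_add, ← Finsupp.single_add,
        ← MonoidAlgebra.single_add, ← map_add]
    | single g r =>
      rw [augmentation_single, ← Coinvariants.mk_self_apply _ g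
        (Finsupp.single i (MonoidAlgebra.single 1 r))]
      simp
  rw [h, hv, MonoidAlgebra.single_zero, Finsupp.single_zero, map_zero]

/-- A relation is the derivative of a word with zero exponent sums. This makes H_0(K) → H_0(R^n)
vanish, as dimension shifting requires. -/
theorem augmentation_relation (v : Fin n →₀ LatticeRing n) (hv : koszulLin v = 0) (i : Fin n) :
    augmentation _ (v i) = 0 := by
  obtain ⟨w, hw, rfl⟩ := exists_fox_eq v hv
  rw [augmentation_fox, hw]
  rfl

theorem augRep_freeOfRank (k : ℕ) :
    FreeOfRank ℤ (groupHomology (kerObj (augmentation (Multiplicative (Fin n → ℤ)))) k)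
      (n.choose (k + 1)) := by
  have hX := repComplex_shortExact (exact_kerIncl_augmentation (n := n))
    (kerIncl_injective _) augmentation_surjective
  refine FreeOfRank.groupHomology_of_shortExact hX
    (isZero_groupHomology_of_projective (Rep.leftRegular ℤ (Multiplicative (Fin n → ℤ)))) ?_
    (groupHomology_trivial_freeOfRank n (k + 1))
  refine groupHomology_map_zero_eq_zero _ fun x => ?_
  refine (coinvariants_mk_leftRegular _).trans ?_
  have hx : augmentation (Multiplicative (Fin n → ℤ)) (kerIncl (augmentation _) x) = 0 := x.2
  exact (congr_arg (fun r => Coinvariants.mk (leftRegular ℤ (Multiplicative (Fin n → ℤ)))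
    (MonoidAlgebra.single 1 r)) hx).trans (by rw [MonoidAlgebra.single_zero, map_zero])

theorem relRep_freeOfRank (k : ℕ) :
    FreeOfRank ℤ (groupHomology (kerObj (koszul (n := n))) k) (n.choose (k + 2)) := by
  have hX := repComplex_shortExact (exact_kerIncl_koszulAug (n := n))
    (kerIncl_injective _) koszulAug_surjective
  refine FreeOfRank.groupHomology_of_shortExact hX
    (isZero_groupHomology_of_projective (Rep.free ℤ (Multiplicative (Fin n → ℤ)) (Fin n))) ?_
    (augRep_freeOfRank (k + 1))
  refine groupHomology_map_zero_eq_zero _ fun x => ?_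
  exact coinvariants_mk_free _ (augmentation_relation _ x.2)

end KoszulHomology

/-! ### The commutator subgroup of a surface group -/

section SurfaceModule

open CategoryTheory Representation

variable {g : ℕ}

/-- The projection from the free group onto the surface group. -/
abbrev surfaceMk (g : ℕ) : FreeGroup (Fin (2 * g)) →* SurfaceGroup g := PresentedGroup.mk _

theorem abEquivLattice_of_surfaceMk (w : FreeGroup (Fin (2 * g))) :
    abEquivLattice g (Abelianization.of (surfaceMk g w)) = freeAb (2 * g) w := by
  have h : (((abEquivLattice g).toMonoidHom.comp Abelianization.of).comp (surfaceMk g)) =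
      freeAb (2 * g) := by
    refine FreeGroup.ext_hom _ _ fun i => ?_
    rw [freeAb_of]
    change toLattice g (Abelianization.of (PresentedGroup.of i)) = _
    rw [toLattice, Abelianization.lift_apply_of, PresentedGroup.toGroup.of]
  exact congr($h w)

theorem abEquivLattice_symm_freeAb (w : FreeGroup (Fin (2 * g))) :
    (abEquivLattice g).symm (freeAb (2 * g) w) = Abelianization.of (surfaceMk g w) := by
  rw [← abEquivLattice_of_surfaceMk, MulEquiv.symm_apply_apply]

theorem surfaceMk_mem_commutator_iff (w : FreeGroup (Fin (2 * g))) :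
    surfaceMk g w ∈ commutator (SurfaceGroup g) ↔ freeAb (2 * g) w = 1 := by
  rw [← Abelianization.ker_of, MonoidHom.mem_ker, ← abEquivLattice_of_surfaceMk,
    (abEquivLattice g).map_eq_one_iff]

/-- The class in `[π, π]^ab` of an element of the commutator subgroup of the free group. -/
def commClass (g : ℕ) :
    (freeAb (2 * g)).ker →* Abelianization (commutator (SurfaceGroup g)) :=
  Abelianization.of.comp (((surfaceMk g).comp (freeAb (2 * g)).ker.subtype).codRestrict _
    fun w => (surfaceMk_mem_commutator_iff w.1).2 w.2)

theorem surfaceRep_commClass (u : FreeGroup (Fin (2 * g))) (w : (freeAb (2 * g)).ker) :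
    surfaceRep g (freeAb (2 * g) u) (Additive.ofMul (commClass g w)) =
      Additive.ofMul (commClass g (MulAut.conjNormal u w)) := by
  change conjRepAb _ ((abEquivLattice g).symm _) _ = _
  rw [abEquivLattice_symm_freeAb]
  change Additive.ofMul (Abelianization.of _) = _
  congr 2

/-- The class of `s(a) w s(a w)⁻¹` in `[π, π]^ab`, where `s` is the section of the
abelianization. -/
def schreier (a : Multiplicative (Lattice g)) (w : FreeGroup (Fin (2 * g))) :
    Additive (Abelianization (commutator (SurfaceGroup g))) :=
  Additive.ofMul (commClass g ⟨freeSec a * w * (freeSec (a * freeAb (2 * g) w))⁻¹, by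
    rw [MonoidHom.mem_ker]; simp⟩)

theorem schreier_mul (a : Multiplicative (Lattice g)) (w w' : FreeGroup (Fin (2 * g))) :
    schreier a (w * w') = schreier a w + schreier (a * freeAb (2 * g) w) w' := by
  rw [schreier, schreier, schreier, ← ofMul_mul, ← map_mul]
  congr 2
  ext
  simp only [Subgroup.coe_mul, map_mul, mul_assoc, inv_mul_cancel_left]

theorem schreier_one (a : Multiplicative (Lattice g)) : schreier a 1 = 0 := by
  have h := schreier_mul a 1 1
  simpa using h

theorem schreier_inv (a : Multiplicative (Lattice g)) (w : FreeGroup (Fin (2 * g))) :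
    schreier a w⁻¹ = - schreier (a * (freeAb (2 * g) w)⁻¹) w := by
  have h := schreier_mul a w⁻¹ w
  rw [inv_mul_cancel, schreier_one, map_inv] at h
  exact eq_neg_of_add_eq_zero_left h.symm

theorem schreier_of_mem_ker (u : FreeGroup (Fin (2 * g))) (w : (freeAb (2 * g)).ker) :
    schreier (freeAb (2 * g) u) (w : FreeGroup (Fin (2 * g))) =
      surfaceRep g (freeAb (2 * g) u) (Additive.ofMul (commClass g w)) := by
  -- The action depends only on the abelianization, so u may be replaced by the chosen lift.
  conv_rhs => rw [← freeAb_freeSec (freeAb (2 * g) u)]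
  rw [surfaceRep_commClass, schreier]
  congr 2
  ext
  simp only [MulAut.conjNormal_apply, MonoidHom.mem_ker.1 w.2, mul_one]

/-- The additive map `ℤ[ℤ^{2g}]^{2g} → [π, π]^ab` sending `a e_i` to the class of the Schreier
generator `s(a) x_i s(a x_i)⁻¹`. -/
def schreierLin (g : ℕ) : (Fin (2 * g) →₀ LatticeRing (2 * g)) →ₗ[ℤ]
    Additive (Abelianization (commutator (SurfaceGroup g))) :=
  Finsupp.lsum ℤ fun i => Finsupp.linearCombination ℤ (fun a => schreier a (FreeGroup.of i)) ∘ₗ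
    (MonoidAlgebra.coeffLinearEquiv ℤ).toLinearMap

/-- Both sides obey the same product rule and agree on generators. -/
theorem schreierLin_smul_fox (a : Multiplicative (Lattice g)) (w : FreeGroup (Fin (2 * g))) :
    schreierLin g (latticeOf a • fox w) = schreier a w := by
  induction w using FreeGroup.induction_on generalizing a with
  | C1 => rw [fox_one, smul_zero, map_zero, schreier_one]
  | of i => simp [schreierLin]
  | inv_of i ih =>
    rw [fox_inv, smul_neg, map_neg, ← mul_smul, ← latticeOf_mul, ih, schreier_inv]
  | mul w w' ih ih' =>
    rw [fox_mul, smul_add, map_add, ← mul_smul, ← latticeOf_mul, ih, ih', schreier_mul]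

theorem schreierLin_fox (w : (freeAb (2 * g)).ker) :
    schreierLin g (fox w.1) = Additive.ofMul (commClass g w) := by
  rw [← one_smul (LatticeRing (2 * g)) (fox w.1), ← latticeOf_one, schreierLin_smul_fox,
    ← map_one (freeAb (2 * g)), schreier_of_mem_ker, map_one, map_one]
  rfl

/-- The section need not be multiplicative, so `schreierLin` is built only as a ℤ-linear map. On K
it is equivariant, because there every element is the derivative of a commutator word. -/
theorem schreierLin_smul (a : Multiplicative (Lattice g)) (v : Fin (2 * g) →₀ LatticeRing (2 * g))
    (hv : koszulLin v = 0) :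
    schreierLin g (latticeOf a • v) = surfaceRep g a (schreierLin g v) := by
  obtain ⟨w, hw, rfl⟩ := exists_fox_eq v hv
  rw [schreierLin_smul_fox, schreierLin_fox ⟨w, hw⟩, ← freeAb_freeSec a]
  exact schreier_of_mem_ker _ ⟨w, hw⟩

/-- The Reidemeister–Schreier presentation of `[π, π]^ab`. -/
def schreierMap (g : ℕ) : (relRep (2 * g)).IntertwiningMap (surfaceRep g) :=
  LinearMap.intertwiningMap_of_isIntertwiningMap _ _
    (schreierLin g ∘ₗ (koszul (n := 2 * g)).ker.toSubmodule.subtype) (by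
      rintro a ⟨v, hv⟩
      exact (congr_arg (schreierLin g) (free_apply a v)).trans (schreierLin_smul a v hv))

theorem schreierMap_surjective : Function.Surjective (schreierMap g) := by
  intro x
  induction x using Additive.rec with | _ x =>
  induction x using QuotientGroup.induction_on with | _ c =>
  obtain ⟨w, hw⟩ := PresentedGroup.mk_surjective _ c.1
  have hw' : freeAb (2 * g) w = 1 := by
    rw [← surfaceMk_mem_commutator_iff, surfaceMk, hw]
    exact c.2
  refine ⟨⟨fox w, ?_⟩, (schreierLin_fox ⟨w, hw'⟩).trans ?_⟩
  · exact (koszul_fox w).trans (by rw [hw', latticeOf_one, sub_self])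
  · have h : (⟨surfaceMk g w, (surfaceMk_mem_commutator_iff w).2 hw'⟩ :
        commutator (SurfaceGroup g)) = c := Subtype.ext hw
    exact congr_arg (fun c => Additive.ofMul (Abelianization.of c)) h

theorem freeAb_surfaceRelator : freeAb (2 * g) (surfaceRelator g) = 1 :=
  lift_surfaceRelator g _

/-- Elements of the free commutator subgroup that vanish in `[π, π]^ab` have Fox derivative in the
submodule generated by that of the relator. -/
theorem fox_mem_span_of_commClass_eq_one (w : (freeAb (2 * g)).ker) (hw : commClass g w = 1) :
    fox w.1 ∈ Submodule.span (LatticeRing (2 * g)) {fox (surfaceRelator g)} := by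
  set L := Submodule.span (LatticeRing (2 * g)) {fox (surfaceRelator g)}
  -- T is a normal subgroup containing the relator and all commutators of elements of the kernel of
  -- `freeAb`; it remains to see that w is a product of such elements.
  let T : Subgroup (FreeGroup (Fin (2 * g))) :=
    { carrier := {w | freeAb (2 * g) w = 1 ∧ fox w ∈ L}
      one_mem' := ⟨map_one _, by rw [fox_one]; exact L.zero_mem⟩
      mul_mem' := by
        rintro w w' ⟨h1, h2⟩ ⟨h3, h4⟩
        exact ⟨by rw [map_mul, h1, h3, mul_one], by
          rw [fox_mul]; exact L.add_mem h2 (L.smul_mem _ h4)⟩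
      inv_mem' := by
        rintro w ⟨h1, h2⟩
        exact ⟨by rw [map_inv, h1, inv_one], by
          rw [fox_inv]; exact L.neg_mem (L.smul_mem _ h2)⟩ }
  have hconj (u k : FreeGroup (Fin (2 * g))) (hk : freeAb (2 * g) k = 1) :
      fox (u * k * u⁻¹) = latticeOf (freeAb (2 * g) u) • fox k := by
    rw [fox_mul, fox_mul, map_mul, hk, mul_one, fox_inv, smul_neg, ← mul_smul, ← latticeOf_mul,
      mul_inv_cancel, latticeOf_one, one_smul]
    abel
  have hT : T.Normal := ⟨by
    rintro k ⟨h1, h2⟩ u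
    exact ⟨by rw [map_mul, map_mul, h1, mul_one, map_inv, mul_inv_cancel], by
      rw [hconj u k h1]; exact L.smul_mem _ h2⟩⟩
  have hrel : (surfaceMk g).ker ≤ T := by
    rw [show (surfaceMk g).ker = Subgroup.normalClosure {surfaceRelator g} from
      QuotientGroup.ker_mk' _]
    apply Subgroup.normalClosure_le_normal
    rintro _ rfl
    exact ⟨freeAb_surfaceRelator, Submodule.subset_span rfl⟩
  have hcomm : ⁅(freeAb (2 * g)).ker, (freeAb (2 * g)).ker⁆ ≤ T := by
    rw [Subgroup.commutator_le]
    intro u hu k hk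
    rw [MonoidHom.mem_ker] at hu hk
    refine ⟨by simp [commutatorElement_def, hu, hk], ?_⟩
    rw [commutatorElement_def, fox_mul, hconj u k hk, fox_inv, map_mul, map_mul, hu, hk]
    simp [latticeOf_one, hu]
  have hmap : (freeAb (2 * g)).ker.map (surfaceMk g) = commutator (SurfaceGroup g) := by
    ext c
    constructor
    · rintro ⟨k, hk, rfl⟩
      exact (surfaceMk_mem_commutator_iff k).2 hk
    · intro hc
      obtain ⟨k, rfl⟩ := PresentedGroup.mk_surjective _ c
      exact ⟨k, (surfaceMk_mem_commutator_iff k).1 hc, rfl⟩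
  -- Vanishing in [π,π]^ab puts the image of w in the second derived subgroup of π. This lifts to
  -- commutators of kernel elements, up to a consequence of the relator.
  have h1 : surfaceMk g w.1 ∈ ⁅commutator (SurfaceGroup g), commutator (SurfaceGroup g)⁆ := by
    have h2 := (MonoidHom.mem_ker (f := Abelianization.of
      (G := commutator (SurfaceGroup g)))).2 hw
    rw [Abelianization.ker_of] at h2
    have h3 := Subgroup.mem_map_of_mem (commutator (SurfaceGroup g)).subtype h2
    rw [commutator_def (commutator (SurfaceGroup g)), Subgroup.map_commutator,
      ← MonoidHom.range_eq_map, Subgroup.range_subtype] at h3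
    exact h3
  rw [← hmap, ← Subgroup.map_commutator] at h1
  obtain ⟨k, hk, hkw⟩ := h1
  have h4 : w.1 * k⁻¹ ∈ T := hrel (by rw [MonoidHom.mem_ker, map_mul, map_inv, hkw, mul_inv_cancel])
  have h5 := T.mul_mem h4 (hcomm hk)
  rw [inv_mul_cancel_right] at h5
  exact h5.2

end SurfaceModule

/-! ### The Fox derivative of the surface relator -/

section Relator

open CategoryTheory Representation

/-- The derivative at the identity of an element of the group ring of `ℤ^n`, in the direction of
the `q`-th coordinate. -/
def latticeDeriv {n : ℕ} (q : Fin n) : LatticeRing n →ₗ[ℤ] ℤ :=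
  Finsupp.linearCombination ℤ (fun a : Multiplicative (Fin n → ℤ) => a.toAdd q) ∘ₗ
    (MonoidAlgebra.coeffLinearEquiv ℤ).toLinearMap

@[simp]
theorem latticeDeriv_single {n : ℕ} (q : Fin n) (a : Multiplicative (Fin n → ℤ)) (r : ℤ) :
    latticeDeriv q (MonoidAlgebra.single a r) = r * a.toAdd q := by
  simp [latticeDeriv]

theorem latticeDeriv_mul {n : ℕ} (q : Fin n) (x y : LatticeRing n) :
    latticeDeriv q (x * y) =
      latticeDeriv q x * augmentation _ y + augmentation _ x * latticeDeriv q y := by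
  induction x using MonoidAlgebra.induction_linear with
  | zero => simp
  | add x x' h h' => rw [add_mul, map_add, map_add, map_add, h, h']; ring
  | single a r =>
    induction y using MonoidAlgebra.induction_linear with
    | zero => simp
    | add y y' h h' => rw [mul_add, map_add, map_add, map_add, h, h']; ring
    | single b s => simp [MonoidAlgebra.single_mul_single]; ring

/-- The second-order invariant of words: it counts occurrences of `x_q` before `x_p`. -/
def foxDeriv {n : ℕ} (p q : Fin n) (w : FreeGroup (Fin n)) : ℤ := latticeDeriv q (fox w p)

theorem foxDeriv_mul {n : ℕ} (p q : Fin n) (w w' : FreeGroup (Fin n)) :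
    foxDeriv p q (w * w') = foxDeriv p q w + foxDeriv p q w' +
      (freeAb n w).toAdd q * (freeAb n w').toAdd p := by
  rw [foxDeriv, fox_mul, Finsupp.add_apply, Finsupp.smul_apply, map_add, smul_eq_mul,
    latticeDeriv_mul, augmentation_fox, augmentation_single, latticeDeriv_single,
    foxDeriv, foxDeriv]
  ring

@[simp]
theorem foxDeriv_one {n : ℕ} (p q : Fin n) : foxDeriv p q 1 = 0 := by simp [foxDeriv]

@[simp]
theorem foxDeriv_of {n : ℕ} (p q i : Fin n) : foxDeriv p q (FreeGroup.of i) = 0 := by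
  rw [foxDeriv, fox_of, Finsupp.single_apply]
  split_ifs
  · rw [MonoidAlgebra.one_def, latticeDeriv_single]
    simp
  · simp

theorem foxDeriv_inv {n : ℕ} (p q : Fin n) (w : FreeGroup (Fin n)) :
    foxDeriv p q w⁻¹ = (freeAb n w).toAdd q * (freeAb n w).toAdd p - foxDeriv p q w := by
  have h := foxDeriv_mul p q w⁻¹ w
  rw [inv_mul_cancel, foxDeriv_one, map_inv, toAdd_inv, Pi.neg_apply] at h
  linarith

/-- The cross term in `foxDeriv_mul` is a product of exponent sums, which vanish here. -/
theorem foxDeriv_prod {n : ℕ} (p q : Fin n) (L : List (FreeGroup (Fin n)))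
    (hL : ∀ w ∈ L, freeAb n w = 1) : foxDeriv p q L.prod = (L.map (foxDeriv p q)).sum := by
  induction L with
  | nil => simp
  | cons w L ih =>
    rw [List.prod_cons, List.map_cons, List.sum_cons, foxDeriv_mul, hL w (by simp),
      ih fun w hw => hL w (by simp [hw])]
    simp

theorem oddIdx_ne_evenIdx {g : ℕ} (i j : Fin g) : oddIdx g i ≠ evenIdx g j := by
  intro h
  have := congr_arg Fin.val h
  simp only [oddIdx, evenIdx] at this
  omega

theorem oddIdx_inj {g : ℕ} {i j : Fin g} : oddIdx g i = oddIdx g j ↔ i = j := by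
  simp [oddIdx, Fin.ext_iff]

theorem evenIdx_inj {g : ℕ} {i j : Fin g} : evenIdx g i = evenIdx g j ↔ i = j := by
  simp [evenIdx, Fin.ext_iff]

/-- Only the i-th commutator contains both letters. The x-derivative of x⁻¹y⁻¹xy is -x⁻¹ + x⁻¹y⁻¹,
whose y-derivative at the identity is -1. -/
theorem foxDeriv_surfaceRelator {g : ℕ} (i : Fin g) :
    foxDeriv (oddIdx g i) (evenIdx g i) (surfaceRelator g) = -1 := by
  rw [surfaceRelator, foxDeriv_prod, List.map_ofFn, List.sum_ofFn, Finset.sum_eq_single i]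
  · simp [foxDeriv_mul, foxDeriv_inv, oddIdx_ne_evenIdx, (oddIdx_ne_evenIdx _ _).symm]
  · intro j _ hj
    simp [foxDeriv_mul, foxDeriv_inv, oddIdx_ne_evenIdx, (oddIdx_ne_evenIdx _ _).symm,
      oddIdx_inj, evenIdx_inj, hj.symm]
  · simp
  · intro w hw
    obtain ⟨i, rfl⟩ := (List.mem_ofFn' _ _).1 hw
    simp [mul_comm]

variable {g : ℕ}

theorem koszul_fox_surfaceRelator : koszulLin (fox (surfaceRelator g)) = 0 := by
  rw [koszul_fox, freeAb_surfaceRelator, latticeOf_one, sub_self]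

/-- Multiples of the Fox derivative of the relator. -/
def relatorMap (g : ℕ) :
    (leftRegular ℤ (Multiplicative (Lattice g))).IntertwiningMap (relRep (2 * g)) :=
  LinearMap.intertwiningMap_of_isIntertwiningMap _ _
    (LinearMap.codRestrict (koszul (n := 2 * g)).ker.toSubmodule
      ((LinearMap.toSpanSingleton (LatticeRing (2 * g)) _
        (fox (surfaceRelator g))).restrictScalars ℤ) (fun x => by
          refine (map_smul koszulLin x (fox (surfaceRelator g))).trans ?_
          rw [koszul_fox_surfaceRelator, smul_zero])) (by
      intro a x
      refine Subtype.ext ?_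
      refine Eq.trans ?_ (free_apply a _).symm
      change (leftRegular ℤ (Multiplicative (Lattice g)) a x : LatticeRing (2 * g)) •
        fox (surfaceRelator g) = latticeOf a • (x • fox (surfaceRelator g))
      rw [← mul_smul]
      congr 1
      exact ringRep_apply (MonoidHom.id _) a x)

/-- R is a domain, and one coordinate of the derivative of the relator is nonzero because its
second-order invariant is -1. Genus zero would have no such coordinate. -/
theorem relatorMap_injective (hg : 0 < g) : Function.Injective (relatorMap g) := by
  rw [injective_iff_map_eq_zero]
  intro x hx
  have h1 : x • fox (surfaceRelator g) = 0 := congr_arg Subtype.val hx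
  have h2 : fox (surfaceRelator g) (oddIdx g ⟨0, hg⟩) ≠ 0 := by
    intro h
    have := foxDeriv_surfaceRelator (⟨0, hg⟩ : Fin g)
    rw [foxDeriv, h, map_zero] at this
    omega
  have h3 := DFunLike.congr_fun h1 (oddIdx g ⟨0, hg⟩)
  rw [Finsupp.smul_apply, smul_eq_mul, Finsupp.zero_apply] at h3
  exact (mul_eq_zero.1 h3).resolve_right h2

theorem exact_relatorMap_schreierMap : Function.Exact (relatorMap g) (schreierMap g) := by
  rintro ⟨v, hv⟩
  constructor
  · intro h
    obtain ⟨w, hw, rfl⟩ := exists_fox_eq v hv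
    have h1 : commClass g ⟨w, hw⟩ = 1 :=
      Additive.ofMul.injective ((schreierLin_fox ⟨w, hw⟩).symm.trans h)
    obtain ⟨x, hx⟩ := Submodule.mem_span_singleton.1 (fox_mem_span_of_commClass_eq_one _ h1)
    exact ⟨x, Subtype.ext hx⟩
  · rintro ⟨x, hx⟩
    rw [← hx]
    change schreierLin g (x • fox (surfaceRelator g)) = 0
    induction x using MonoidAlgebra.induction_linear generalizing v with
    | zero => simp
    | add x y h h' =>
      rw [add_smul, map_add, h _ (relatorMap g x).2 rfl, h' _ (relatorMap g y).2 rfl, add_zero]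
    | single a r =>
      have h1 : (MonoidAlgebra.single a r : LatticeRing (2 * g)) = r • latticeOf a := by
        simp
      have h2 : commClass g ⟨surfaceRelator g, freeAb_surfaceRelator⟩ = 1 := by
        have h3 : surfaceMk g (surfaceRelator g) = 1 := PresentedGroup.one_of_mem rfl
        have h4 : (⟨surfaceMk g (surfaceRelator g), (surfaceMk_mem_commutator_iff _).2
            freeAb_surfaceRelator⟩ : commutator (SurfaceGroup g)) = 1 := Subtype.ext h3
        exact (congr_arg Abelianization.of h4).trans (map_one _)
      rw [h1, smul_assoc, map_smul, schreierLin_smul _ _ koszul_fox_surfaceRelator,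
        schreierLin_fox ⟨surfaceRelator g, freeAb_surfaceRelator⟩, h2, ofMul_one, map_zero,
        smul_zero]

/-- An invariant functional on the module of relations which splits the relator in degree zero. -/
def relatorFunctional (i : Fin g) : (relRep (2 * g)).IntertwiningMap
    (Representation.trivial ℤ (Multiplicative (Lattice g)) ℤ) :=
  LinearMap.intertwiningMap_of_isIntertwiningMap _ _
    (-(latticeDeriv (evenIdx g i) ∘ₗ Finsupp.lapply (oddIdx g i) ∘ₗ
      (koszul (n := 2 * g)).ker.toSubmodule.subtype)) (by
      rintro a ⟨v, hv⟩
      change -(latticeDeriv (evenIdx g i) ((Representation.free ℤ _ _ a v) (oddIdx g i))) =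
        -(latticeDeriv (evenIdx g i) (v (oddIdx g i)))
      -- By the Leibniz rule the failure of invariance is a multiple of the augmentation of a
      -- coordinate of v, which is zero for a relation.
      rw [free_apply, Finsupp.smul_apply, smul_eq_mul, latticeDeriv_mul,
        augmentation_relation v hv, augmentation_single, mul_zero, zero_add, one_mul])

theorem relatorFunctional_relatorMap (i : Fin g) (x : LatticeRing (2 * g)) :
    relatorFunctional i (relatorMap g x) = augmentation _ x := by
  change -(latticeDeriv (evenIdx g i) ((x • fox (surfaceRelator g)) (oddIdx g i))) = _
  have h := foxDeriv_surfaceRelator i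
  rw [foxDeriv] at h
  rw [Finsupp.smul_apply, smul_eq_mul, latticeDeriv_mul, h, augmentation_fox,
    freeAb_surfaceRelator]
  simp

end Relator

/-! ### The homology of `[π, π]^ab` -/

section SurfaceHomology

open CategoryTheory Representation

variable {g : ℕ}

section Ker

variable {k G V W U₁ U₃ : Type} [CommRing k] [Group G] [AddCommGroup V] [Module k V]
  [AddCommGroup W] [Module k W] [AddCommGroup U₁] [Module k U₁] [AddCommGroup U₃] [Module k U₃]
  {ρ : Representation k G V} {σ : Representation k G W}
  {ρ₁ : Representation k G U₁} {ρ₃ : Representation k G U₃} {h : ρ.IntertwiningMap σ}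

/-- An intertwining map into a kernel, as a morphism of representations. -/
abbrev toKerObj (f : ρ₁.IntertwiningMap (kerRep h)) : Rep.of ρ₁ ⟶ kerObj h := Rep.ofHom f

/-- An intertwining map out of a kernel, as a morphism of representations. -/
abbrev ofKerObj (p : (kerRep h).IntertwiningMap ρ₃) : kerObj h ⟶ Rep.of ρ₃ := Rep.ofHom p

theorem kerComplex_shortExact {f : ρ₁.IntertwiningMap (kerRep h)}
    {p : (kerRep h).IntertwiningMap ρ₃} (e : Function.Exact f p) (hf : Function.Injective f)
    (hp : Function.Surjective p) :
    (ShortComplex.mk (toKerObj f) (ofKerObj p)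
      (by ext x; exact e.apply_apply_eq_zero x)).ShortExact :=
  repComplex_shortExact e hf hp

theorem toKerObj_comp_ofKerObj {f : ρ₁.IntertwiningMap (kerRep h)}
    {p : (kerRep h).IntertwiningMap ρ₃} {q : ρ₁.IntertwiningMap ρ₃} (e : ∀ x, p (f x) = q x) :
    toKerObj f ≫ ofKerObj p = Rep.ofHom q := by
  ext x
  exact e x

end Ker

/-- The map induced in group homology by a morphism of representations. -/
abbrev homologyMap {k G : Type} [CommRing k] [Group G] {A B : Rep k G} (f : A ⟶ B) (n : ℕ) :
    groupHomology A n ⟶ groupHomology B n :=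
  groupHomology.map (MonoidHom.id G) (A := A) (B := B) f n

/-- The map induced in homology by the relator. -/
abbrev relatorHomologyMap (g n : ℕ) := homologyMap (toKerObj (relatorMap g)) n

/-- The functional composed with the relator map is the augmentation, which is an isomorphism on H_0
of the regular representation. -/
theorem exists_retraction_relatorHomologyMap (hg : 0 < g) :
    ∃ l, l ∘ₗ (relatorHomologyMap g 0).hom = LinearMap.id := by
  let e := LinearEquiv.ofBijective _
    (bijective_groupHomology_map_augmentation (G := Multiplicative (Lattice g)))
  let φ := homologyMap (ofKerObj (relatorFunctional (⟨0, hg⟩ : Fin g))) 0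
  refine ⟨e.symm.toLinearMap ∘ₗ φ.hom, ?_⟩
  have h : relatorHomologyMap g 0 ≫ φ = homologyMap (Rep.ofHom (augmentation _)) 0 := by
    rw [← groupHomology.map_id_comp,
      toKerObj_comp_ofKerObj (relatorFunctional_relatorMap (⟨0, hg⟩ : Fin g))]
  have h1 : φ.hom ∘ₗ (relatorHomologyMap g 0).hom = e.toLinearMap := congr_arg ModuleCat.Hom.hom h
  rw [LinearMap.comp_assoc, h1]
  exact e.symm_comp

theorem relatorHomologyMap_injective (hg : 0 < g) (n : ℕ) :
    Function.Injective (relatorHomologyMap g n).hom := by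
  cases n with
  | zero =>
    obtain ⟨l, hl⟩ := exists_retraction_relatorHomologyMap hg
    exact Function.LeftInverse.injective (g := l) fun x => congr($hl x)
  | succ n =>
    have := ModuleCat.subsingleton_of_isZero (isZero_groupHomology_of_projective
      (Rep.leftRegular ℤ (Multiplicative (Lattice g))) n)
    exact Function.injective_of_subsingleton _

theorem surfaceRep_freeOfRank_zero (hg : 0 < g) :
    FreeOfRank ℤ (groupHomology (Rep.of (surfaceRep g)) 0) ((2 * g).choose 2 - 1) := by
  have hX := kerComplex_shortExact (exact_relatorMap_schreierMap (g := g))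
    (relatorMap_injective hg) schreierMap_surjective
  obtain ⟨l, hl⟩ := exists_retraction_relatorHomologyMap hg
  exact FreeOfRank.coker hl (exact_groupHomology_map hX 0)
    (surjective_groupHomology_map_zero _ ((Rep.epi_iff_surjective _).1 hX.epi_g))
    freeOfRank_groupHomology_zero_leftRegular (relRep_freeOfRank 0)

theorem surfaceRep_freeOfRank_succ (hg : 0 < g) (k : ℕ) :
    FreeOfRank ℤ (groupHomology (Rep.of (surfaceRep g)) (k + 1)) ((2 * g).choose (k + 3)) := by
  have hX := kerComplex_shortExact (exact_relatorMap_schreierMap (g := g))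
    (relatorMap_injective hg) schreierMap_surjective
  refine (relRep_freeOfRank (k + 1)).of_equiv (LinearEquiv.ofBijective
    (homologyMap (ofKerObj (schreierMap g)) (k + 1)).hom ⟨?_, ?_⟩)
  · rw [injective_iff_map_eq_zero]
    intro x hx
    obtain ⟨y, rfl⟩ := (exact_groupHomology_map hX (k + 1) x).1 hx
    have := ModuleCat.subsingleton_of_isZero (isZero_groupHomology_of_projective
      (Rep.leftRegular ℤ (Multiplicative (Lattice g))) k)
    have hy : y = 0 := Subsingleton.elim (α := groupHomology
      (Rep.leftRegular ℤ (Multiplicative (Lattice g))) (k + 1)) _ _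
    rw [hy, map_zero]
  · intro y
    -- Surjectivity means that the connecting map to H_k(R) is zero, which follows from injectivity
    -- of H_k(R) → H_k(K). For k = 0 this is where the retraction is needed.
    refine (exact_groupHomology_map_δ hX k y).1 (relatorHomologyMap_injective hg k ?_)
    rw [map_zero]
    exact (exact_groupHomology_δ_map hX k).apply_apply_eq_zero y

end SurfaceHomology

/-! ### The exterior powers -/

section Exterior

variable {g : ℕ}

theorem exteriorPower_freeOfRank (g k : ℕ) :
    FreeOfRank ℤ (⋀[ℤ]^k (Lattice g)) ((2 * g).choose k) :=
  ⟨inferInstance, inferInstance, by rw [exteriorPower.finrank_eq, Module.finrank_fin_fun]⟩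

/-- The functional `e_p* ∧ e_q*` on `⋀² ℤ^{2g}`. -/
def wedgeFunctional (p q : Fin (2 * g)) : ⋀[ℤ]^2 (Lattice g) →ₗ[ℤ] ℤ :=
  exteriorPower.alternatingMapLinearEquiv
    ((Matrix.detRowAlternating (n := Fin 2) (R := ℤ)).compLinearMap
      (LinearMap.funLeft ℤ ℤ ![p, q]))

theorem wedgeFunctional_ιMulti (p q : Fin (2 * g)) (v w : Lattice g) :
    wedgeFunctional p q (exteriorPower.ιMulti ℤ 2 ![v, w]) = v p * w q - v q * w p := by
  rw [wedgeFunctional, exteriorPower.alternatingMapLinearEquiv_apply_ιMulti]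
  exact Matrix.det_fin_two _

/-- Taking the value 1 under a functional makes ω primitive, so the quotient by ℤω is free as well.
-/
theorem wedgeFunctional_omega (i : Fin g) :
    wedgeFunctional (oddIdx g i) (evenIdx g i) (omega g) = 1 := by
  rw [omega, map_sum, Finset.sum_eq_single i]
  · simp [wedgeFunctional_ιMulti, oddIdx_ne_evenIdx, (oddIdx_ne_evenIdx _ _).symm]
  · intro j _ hj
    simp [wedgeFunctional_ιMulti, oddIdx_ne_evenIdx, (oddIdx_ne_evenIdx _ _).symm,
      oddIdx_inj, evenIdx_inj, hj.symm]
  · simp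

theorem wedgeFunctional_comp_toSpanSingleton (i : Fin g) :
    wedgeFunctional (oddIdx g i) (evenIdx g i) ∘ₗ
      LinearMap.toSpanSingleton ℤ _ (omega g) = LinearMap.id := by
  ext
  simp [wedgeFunctional_omega]

theorem exteriorPower_quotient_freeOfRank (hg : 0 < g) :
    FreeOfRank ℤ ((⋀[ℤ]^2 (Lattice g)) ⧸ Submodule.span ℤ {omega g})
      ((2 * g).choose 2 - 1) := by
  refine FreeOfRank.coker (g := Submodule.mkQ _)
    (wedgeFunctional_comp_toSpanSingleton (⟨0, hg⟩ : Fin g)) ?_ (Submodule.mkQ_surjective _)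
    ⟨inferInstance, inferInstance, Module.finrank_self ℤ⟩ (exteriorPower_freeOfRank g 2)
  rw [LinearMap.exact_iff, Submodule.ker_mkQ, LinearMap.range_toSpanSingleton]

end Exterior

end SurfaceCommutator

end

theorem theoremD (g : ℕ) (hg : 1 ≤ g) :
    -- `H_0` is the quotient of `⋀² ℤ^{2g}` by an infinite cyclic subgroup, namely `ℤ · ω`
    (Function.Injective (fun n : ℤ => n • SurfaceCommutator.omega g) ∧
      Nonempty (groupHomology (Rep.of (SurfaceCommutator.surfaceRep g)) 0 ≃ₗ[ℤ]
        ((⋀[ℤ]^2 (SurfaceCommutator.Lattice g)) ⧸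
          Submodule.span ℤ {SurfaceCommutator.omega g}))) ∧
    -- higher homology
    (∀ k : ℕ, 1 ≤ k →
      Nonempty (groupHomology (Rep.of (SurfaceCommutator.surfaceRep g)) k ≃ₗ[ℤ]
        ⋀[ℤ]^(k + 2) (SurfaceCommutator.Lattice g))) ∧
    -- the module is not free over the group ring of `ℤ^{2g}`
    (2 ≤ g → ¬ Module.Free (MonoidAlgebra ℤ (Multiplicative (SurfaceCommutator.Lattice g)))
      (SurfaceCommutator.surfaceRep g).asModule) := by
  refine ⟨⟨?_, ?_⟩, ?_, ?_⟩
  · intro m n h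
    have hl := SurfaceCommutator.wedgeFunctional_comp_toSpanSingleton (⟨0, hg⟩ : Fin g)
    exact (Function.LeftInverse.injective (g := SurfaceCommutator.wedgeFunctional _ _)
      (f := LinearMap.toSpanSingleton ℤ _ (SurfaceCommutator.omega g)) fun x => congr($hl x)) h
  · exact (SurfaceCommutator.surfaceRep_freeOfRank_zero hg).nonempty_equiv
      (SurfaceCommutator.exteriorPower_quotient_freeOfRank hg)
  · intro k hk
    obtain ⟨k, rfl⟩ := Nat.exists_eq_add_of_le' hk
    exact (SurfaceCommutator.surfaceRep_freeOfRank_succ hg k).nonempty_equiv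
      (SurfaceCommutator.exteriorPower_freeOfRank g (k + 1 + 2))
  · intro hg' hfree
    -- A free module would have H_1 = 0, while H_1 has rank C(2g, 3), positive once 2g ≥ 3.
    have := ModuleCat.subsingleton_of_isZero
      (SurfaceCommutator.isZero_groupHomology_of_free (SurfaceCommutator.surfaceRep g) 0)
    obtain ⟨-, -, h⟩ := SurfaceCommutator.surfaceRep_freeOfRank_succ hg 0
    rw [Module.finrank_zero_of_subsingleton] at h
    exact (Nat.choose_pos (n := 2 * g) (k := 3) (by omega)).ne h
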